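/- Let $q$ be a prime power, let $\omega$ be a generator of $\mathbb{F}_q^*$, let $n\ge 3$, and let $r>1$ be an integer dividing $q-1$. Let $V=\mathbb{F}_q^n$ with a fixed basis $e_1,\dots,e_n$, and let $\Omega=\{\langle\omega^r\rangle u \mid u\in V\setminus\{0\}\}$, on which $\Gamma\mathrm{L}_n(q)$ acts naturally. For a set $T$ of nonzero vectors write $\langle\omega^r\rangle T=\{\langle\omega^r\rangle v\mid v\in T\}\subseteq\Omega$. Let $Y=\langle\omega^r I\rangle$ be the group of scalar maps by elements of $\langle\omega^r\rangle$, and let $G$ be a group with $Y\,\mathrm{SL}_n(q)\le G\le \Gamma\mathrm{L}_n(q)$ acting on $\Omega$ with rank $3$ (that is, $G$ is transitive on $\Omega$ and each point stabiliser has exactly three orbits on $\Omega$). Put $\alpha=\langle\omega^r\rangle e_1$ and $\sigma=\{\langle\omega^r\rangle\omega^i e_1\mid 0\le i<r\}$. Let $B$ be a nontrivial block of $G_\alpha$ in its action on $\Omega\setminus\sigma$ (that is, $|B|>1$ and $B\ne\Omega\setminus\sigma$) that contains $\langle\omega^r\rangle e_2$. Then one of the following holds. 1. $B=B_1=\langle\omega^r\rangle\{e_2,\omega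 e_2,\dots,\omega^{r-1}e_2\}$, and $|B|=r$. 2. $B=B_2=\langle\omega^r\rangle\{\lambda e_1+e_2\mid\lambda\in\mathbb{F}_q\}$, and $|B|=q$. 3. $B=B_3=S=\langle\omega^r\rangle\{\lambda_1e_1+\lambda_2e_2\mid\lambda_1\in\mathbb{F}_q,\ \lambda_2\in\mathbb{F}_q^*\}$, and $|B|=qr$. 4. One of the following exceptions occurs: - $(q,r)=(3,2)$, $|B|=2$, and $B$ is $\langle\omega^2\rangle\{e_2,2e_1+2e_2\}$ or $\langle\omega^2\rangle\{e_2,e_1+2e_2\}$; - $(q,r)=(4,3)$, and either $B=\langle\omega^3\rangle\{e_2,e_1+e_2\}$ with $|B|=2$, or $B=\langle\omega^3\rangle\{(1+\lambda)e_1+\lambda e_2\mid\lambda\in\mathbb{F}_4^*\}$ with $|B|=3$; - $(q,r)=(16,5)$, $|B|=4$, and $B=\langle\omega^5\rangle\{\lambda e_1+e_2\mid\lambda\in\mathbb{F}_4\}$, where $\mathbb{F}_4$ is the subfield of order $4$ of $\mathbb{F}_{16}$. -/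

import Mathlib

open MulAction

namespace RankThree

/-- The group `ΓL_n(F)` of all invertible semilinear transformations of `F ^ n`. -/
def GammaL (F : Type*) [Field F] (n : ℕ) : Subgroup (Equiv.Perm (Fin n → F)) where
  carrier := {f | (∀ u v : Fin n → F, f (u + v) = f u + f v) ∧
    ∃ τ : F ≃+* F, ∀ (c : F) (v : Fin n → F), f (c • v) = τ c • f v}
  one_mem' := ⟨fun _ _ => rfl, RingEquiv.refl F, fun _ _ => rfl⟩
  mul_mem' := by
    rintro f g ⟨hf, τ, hτ⟩ ⟨hg, ρ, hρ⟩
    exact ⟨fun u v => by simp [hf, hg], ρ.trans τ, fun c v => by simp [hτ, hρ]⟩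
  inv_mem' := by
    rintro f ⟨hf, τ, hτ⟩
    refine ⟨fun u v => ?_, τ.symm, fun c v => ?_⟩
    · apply f.injective
      simp [hf]
    · apply f.injective
      simp [hτ]

/-- `SL_n(F)` as a subgroup of `ΓL_n(F)`: the maps `v ↦ v A` on row vectors with `det A = 1`. -/
def SL (F : Type*) [Field F] (n : ℕ) : Subgroup (GammaL F n) where
  carrier := {f | ∃ A : Matrix.SpecialLinearGroup (Fin n) F,
    ∀ v : Fin n → F, f.1 v = Matrix.vecMul v (A : Matrix (Fin n) (Fin n) F)}
  one_mem' := ⟨1, fun v => by simp⟩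
  mul_mem' := by
    rintro f g ⟨A, hA⟩ ⟨B, hB⟩
    refine ⟨B * A, fun v => ?_⟩
    simp [hA, hB, Matrix.vecMul_vecMul]
  inv_mem' := by
    rintro f ⟨A, hA⟩
    refine ⟨A⁻¹, fun v => ?_⟩
    apply f.1.injective
    have h : ((A⁻¹ : Matrix.SpecialLinearGroup (Fin n) F) : Matrix (Fin n) (Fin n) F) * A = 1 := by
      rw [← Matrix.SpecialLinearGroup.coe_mul, inv_mul_cancel, Matrix.SpecialLinearGroup.coe_one]
    refine (Equiv.apply_symm_apply f.1 v).trans ?_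
    rw [hA, Matrix.vecMul_vecMul, h, Matrix.vecMul_one]

/-- The group `Y = ⟨ω ^ r I⟩` of scalar maps `v ↦ c v` with `c ∈ ⟨ω ^ r⟩`. -/
def Y {F : Type*} [Field F] (ω : Fˣ) (r n : ℕ) : Subgroup (GammaL F n) where
  carrier := {f | ∃ c ∈ Subgroup.zpowers (ω ^ r), ∀ v : Fin n → F, f.1 v = (c : F) • v}
  one_mem' := ⟨1, one_mem _, fun v => by simp⟩
  mul_mem' := by
    rintro f g ⟨c, hc, hf⟩ ⟨d, hd, hg⟩
    exact ⟨c * d, mul_mem hc hd, fun v => by simp [hf, hg, mul_smul]⟩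
  inv_mem' := by
    rintro f ⟨c, hc, hf⟩
    refine ⟨c⁻¹, inv_mem hc, fun v => ?_⟩
    apply f.1.injective
    refine (Equiv.apply_symm_apply f.1 v).trans ?_
    rw [hf, smul_smul, Units.mul_inv, one_smul]

/-- The set of vectors `⟨ω ^ r⟩ u`. -/
def ray {F : Type*} [Field F] (ω : Fˣ) (r : ℕ) {n : ℕ} (u : Fin n → F) : Set (Fin n → F) :=
  {v | ∃ c ∈ Subgroup.zpowers (ω ^ r), v = (c : F) • u}

/-- The point set `Ω = {⟨ω ^ r⟩ u | u ≠ 0}`. -/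
def Omega {F : Type*} [Field F] (ω : Fˣ) (r n : ℕ) : Type _ :=
  {A : Set (Fin n → F) // ∃ u : Fin n → F, u ≠ 0 ∧ A = ray ω r u}

/-- The set `⟨ω ^ r⟩ T = {⟨ω ^ r⟩ v | v ∈ T}` of points of `Ω`, for a set `T` of vectors. -/
def points {F : Type*} [Field F] (ω : Fˣ) (r : ℕ) {n : ℕ} (T : Set (Fin n → F)) :
    Set (Omega ω r n) :=
  {x | ∃ v ∈ T, x.1 = ray ω r v}

/-- Field automorphisms of a finite field preserve the cyclic group `⟨ω ^ r⟩`. -/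
theorem map_mem_zpowers {F : Type*} [Field F] [Finite F] (τ : F ≃+* F) (ω : Fˣ) (r : ℕ)
    {c : Fˣ} (hc : c ∈ Subgroup.zpowers (ω ^ r)) :
    Units.map (τ : F →* F) c ∈ Subgroup.zpowers (ω ^ r) := by
  obtain ⟨m, hm⟩ := MonoidHom.map_cyclic (Units.map (τ : F →* F))
  rw [hm]
  exact Subgroup.zpow_mem _ hc m

theorem image_ray {F : Type*} [Field F] [Finite F] (ω : Fˣ) (r : ℕ) {n : ℕ} (g : GammaL F n)
    (u : Fin n → F) : g.1 '' ray ω r u = ray ω r (g.1 u) := by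
  obtain ⟨-, τ, hτ⟩ := g.2
  ext v
  constructor
  · rintro ⟨_, ⟨c, hc, rfl⟩, rfl⟩
    exact ⟨_, map_mem_zpowers τ ω r hc, hτ _ _⟩
  · rintro ⟨c, hc, rfl⟩
    refine ⟨_, ⟨_, map_mem_zpowers τ.symm ω r hc, rfl⟩, ?_⟩
    rw [hτ]
    simp

theorem GammaL_map_ne_zero {F : Type*} [Field F] {n : ℕ} (g : GammaL F n) {u : Fin n → F}
    (hu : u ≠ 0) : g.1 u ≠ 0 := by
  intro h
  obtain ⟨hg, -⟩ := g.2
  have h0 : g.1 0 = 0 := by simpa using hg 0 0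
  exact hu (g.1.injective (h.trans h0.symm))

/-- The action of `ΓL_n(F)` on `Ω`; it sends `⟨ω ^ r⟩ u` to `⟨ω ^ r⟩ (g u)`. -/
instance {F : Type*} [Field F] [Finite F] (ω : Fˣ) (r n : ℕ) :
    MulAction (GammaL F n) (Omega ω r n) where
  smul g x := ⟨g.1 '' x.1, by
    obtain ⟨u, hu, hx⟩ := x.2
    exact ⟨g.1 u, GammaL_map_ne_zero g hu, by rw [hx, image_ray]⟩⟩
  one_smul x := Subtype.ext (Set.image_id x.1)
  mul_smul g h x := Subtype.ext (Set.image_comp g.1 h.1 x.1)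

/-- A group acts with rank `3` if it is transitive and its point stabilisers have exactly
three orbits. -/
def HasRankThree (G X : Type*) [Group G] [MulAction G X] : Prop :=
  IsPretransitive G X ∧ ∀ x : X, Nat.card (orbitRel.Quotient (stabilizer G x) X) = 3

/-- The part `σ(⟨u⟩) = {⟨ω ^ r⟩ ω ^ i u | 0 ≤ i < r}` of the invariant partition `Σ` of `Ω`. -/
def sigma {F : Type*} [Field F] (ω : Fˣ) (r : ℕ) {n : ℕ} (u : Fin n → F) : Set (Omega ω r n) :=
  points ω r {v | ∃ i < r, v = ((ω ^ i : Fˣ) : F) • u}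

/-- `B` is a nontrivial block of `H` in its action on the `H`-invariant set `D`: its
`H`-translates are equal or disjoint, it has more than one point, and it is not `D`. -/
def IsNontrivialBlockOn (H : Type*) {X : Type*} [Group H] [MulAction H X] (D B : Set X) : Prop :=
  B ⊆ D ∧ IsBlock H B ∧ B.Nontrivial ∧ B ≠ D

end RankThree

/-! Write C = ⟨ω^r⟩ and F for the field, and study B through the vectors on its points.
Transvections fixing e₁ lie in the stabiliser of α, and the block property for them forces B either
to lie in the plane ⟨e₁, e₂⟩ or to contain every point outside ⟨e₁⟩; the latter is excluded.

In the plane, let (x, y) with y ≠ 0 stand both for x e₁ + y e₂ and for the map that fixes e₁ and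
sends e₂ to that vector. As n ≥ 3, SL_n induces all these maps, so the pairs coming from B form a
subgroup Q of F ⋊ Fˣ that contains 0 ⋊ C. Rank 3 supplies a set Δ of field automorphisms that
preserve Q and permute the nontrivial cosets of C transitively. In particular r - 1 ≤ |Aut F|, so r
is very small compared with |F|.

Such Q are classified in `IsAffineSubgroup.classification` by the translation part A, the projection
D to Fˣ, and the field K of multipliers of A, which contains D. By transitivity D is C or Fˣ. If D =
C, then Q = A ⋊ C. Either K = F and A is 0 or F, or K is proper; then `subfield_card_of_zpowers_le`
leaves only |F| = 4 or 16, and an automorphism that squares modulo C forces A = K. If D = Fˣ, then K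
= F. Here A = F makes Q everything, while A = 0 makes Q a complement {(a(1 - y), y)}; containing 0 ⋊
C means a = 0 or C = 1, and C = 1 forces |F| ≤ 4. The case A = 0, D = C is the single point β. -/

namespace RankThree

/-! ### Automorphisms and subfields of a finite field -/

section FiniteField

variable {F : Type*} [Field F] [Finite F]

theorem zpow_mem_zpowers_pow_iff {A : Type*} [Group A] {ω : A} {r : ℕ} (h : r ∣ orderOf ω) (m : ℤ) :
    ω ^ m ∈ Subgroup.zpowers (ω ^ r) ↔ (r : ℤ) ∣ m := by
  constructor
  · rintro ⟨k, hk⟩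
    have h1 : ω ^ (m - r * k) = 1 := by
      rw [zpow_sub, zpow_mul, zpow_natCast, mul_inv_eq_one]
      exact hk.symm
    have h2 := (Int.natCast_dvd_natCast.2 h).trans (orderOf_dvd_iff_zpow_eq_one.2 h1)
    exact (Int.dvd_iff_dvd_of_dvd_sub h2).2 (Dvd.intro _ rfl)
  · rintro ⟨k, rfl⟩
    exact ⟨k, by simp [zpow_mul]⟩

omit [Finite F] in
theorem orderOf_generator {ω : Fˣ} (hω : ∀ x : Fˣ, x ∈ Subgroup.zpowers ω) :
    orderOf ω = Nat.card F - 1 := by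
  rw [orderOf_eq_card_of_forall_mem_zpowers hω, Nat.card_units]

omit [Finite F] in
theorem card_zpowers_pow {ω : Fˣ} (hω : ∀ x : Fˣ, x ∈ Subgroup.zpowers ω) {r : ℕ} (hr : 1 < r)
    (hrq : r ∣ Nat.card F - 1) : Nat.card (Subgroup.zpowers (ω ^ r)) * r = Nat.card F - 1 := by
  rw [Nat.card_zpowers, orderOf_pow_of_dvd (by omega) (by rwa [orderOf_generator hω]),
    orderOf_generator hω, Nat.div_mul_cancel hrq]

/-- The number of automorphisms of the field of order `p ^ f` is at most `f`. -/
theorem card_ringAut_le {p f : ℕ} [Fact p.Prime] (hq : Nat.card F = p ^ f) :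
    Nat.card (F ≃+* F) ≤ f := by
  have hf : f ≠ 0 := by
    rintro rfl
    have := Finite.one_lt_card (α := F)
    rw [hq, pow_zero] at this
    omega
  have : Fintype F := Fintype.ofFinite F
  have hp : CharP F p := by
    have h := FiniteField.cast_card_eq_zero F
    rw [← Nat.card_eq_fintype_card, hq] at h
    push_cast at h
    have := CharP.ringChar_of_prime_eq_zero (Fact.out (p := p.Prime)) (pow_eq_zero_iff hf |>.1 h)
    exact this ▸ ringChar.charP F
  let _ : Algebra (ZMod p) F := ZMod.algebra F p
  have hfin : Module.finrank (ZMod p) F = f := by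
    have h := Module.natCard_eq_pow_finrank (K := ZMod p) (V := F)
    rw [hq, Nat.card_zmod] at h
    exact (Nat.pow_right_injective (Fact.out (p := p.Prime)).two_le h).symm
  rw [← hfin, ← IsGalois.card_aut_eq_finrank (ZMod p) F]
  refine Nat.card_le_card_of_injective
    (fun τ : F ≃+* F => AlgEquiv.ofRingEquiv (f := τ) (R := ZMod p) fun x => ?_) ?_
  · exact RingHom.congr_fun (Subsingleton.elim ((τ : F →+* F).comp (algebraMap (ZMod p) F))
      (algebraMap (ZMod p) F)) x
  · intro τ ρ h
    ext x
    exact congrArg (fun e : F ≃ₐ[ZMod p] F => e x) h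

/-- The automorphisms in `Δ` permute the nontrivial cosets of `C` in `Fˣ` transitively. -/
def TransitiveOnCosets (Δ : Set (F ≃+* F)) (C : Subgroup Fˣ) : Prop :=
  ∀ i j : Fˣ, i ∉ C → j ∉ C → ∃ τ ∈ Δ, ∃ c ∈ C, τ i = (j * c : F)

/-- Moving ω into each of the r - 1 nontrivial cosets takes a different automorphism each time. -/
theorem TransitiveOnCosets.le_card {Δ : Set (F ≃+* F)} {ω : Fˣ} {r : ℕ} (hr : 1 < r)
    (hrq : r ∣ orderOf ω) (h : TransitiveOnCosets Δ (Subgroup.zpowers (ω ^ r))) :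
    r ≤ Nat.card (F ≃+* F) + 1 := by
  have hmem (m : ℕ) (h0 : m ≠ 0) (h1 : m < r) : ω ^ m ∉ Subgroup.zpowers (ω ^ r) := by
    rw [← zpow_natCast ω m, zpow_mem_zpowers_pow_iff hrq, Int.natCast_dvd_natCast]
    exact fun hd => absurd (Nat.le_of_dvd (by omega) hd) (by omega)
  have h1 (m : Fin (r - 1)) := h ω (ω ^ (m.1 + 1)) (by simpa using hmem 1 one_ne_zero hr)
    (hmem _ (by omega) (by omega))
  choose τ hτ c hc hτc using h1
  have hinj : Function.Injective τ := by
    intro m m' hmm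
    have h2 : ω ^ (m.1 + 1) * c m = ω ^ (m'.1 + 1) * c m' := by
      ext
      push_cast
      have := (hτc m).symm.trans ((congrArg (fun e : F ≃+* F => e ω) hmm).trans (hτc m'))
      simpa using this
    have h3 : ω ^ ((m.1 + 1 : ℕ) - (m'.1 + 1 : ℕ) : ℤ) ∈ Subgroup.zpowers (ω ^ r) := by
      rw [zpow_sub, zpow_natCast, zpow_natCast]
      have : ω ^ (m.1 + 1) * (ω ^ (m'.1 + 1))⁻¹ = c m' * (c m)⁻¹ := by
        rw [mul_inv_eq_iff_eq_mul, mul_right_comm, eq_mul_inv_iff_mul_eq, h2, mul_comm]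
      rw [this]
      exact mul_mem (hc _) (inv_mem (hc _))
    rw [zpow_mem_zpowers_pow_iff hrq] at h3
    have h4 := Int.eq_zero_of_abs_lt_dvd h3 (by rw [abs_lt]; constructor <;> push_cast <;> omega)
    ext
    omega
  have : Finite (F ≃+* F) := Finite.of_injective _ DFunLike.coe_injective
  have := Nat.card_le_card_of_injective τ hinj
  rw [Nat.card_fin] at this
  omega

/-- The hypothesis bounds 1 + k + ... + k^(m-1) by em + 1. For k = p^e the bound is linear in m with
slope e ≤ k/2, whereas every term of the sum after the first is at least k, so there is room only
for m = 2. -/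
theorem geom_le_imp {k m e : ℕ} (hm : 2 ≤ m) (hek : 2 * e ≤ k) (hk : 2 ≤ k)
    (h : k ^ m - 1 ≤ (k - 1) * (e * m + 1)) : m = 2 ∧ k = 2 * e := by
  -- Divided by 2(k - 1), this says that 1 + k + ... + k^(m-1) is at least 1 + k + (m - 2)k.
  have key : ∀ m, 2 ≤ m → 2 * (k - 1) * ((m - 2) * k) + 2 * (k ^ 2 - 1) ≤ 2 * (k ^ m - 1) := by
    intro m hm
    induction m, hm using Nat.le_induction with
    | base => simp
    | succ m hm ih =>
      obtain ⟨k, rfl⟩ := Nat.exists_eq_add_of_le' hk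
      obtain ⟨m, rfl⟩ := Nat.exists_eq_add_of_le' hm
      have h1 : (k + 2) ≤ (k + 2) ^ (m + 2) := Nat.le_self_pow (by omega) _
      have h2 : (k + 2) ^ (m + 2 + 1) = (k + 2) ^ (m + 2) * (k + 1) + (k + 2) ^ (m + 2) := by ring
      have h3 : (k + 2) * (k + 1) ≤ (k + 2) ^ (m + 2) * (k + 1) := Nat.mul_le_mul_right _ h1
      have e1 : m + 2 + 1 - 2 = m + 1 := by omega
      have e2 : m + 2 - 2 = m := by omega
      have e3 : k + 2 - 1 = k + 1 := by omega
      rw [e1, e3]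
      rw [e2, e3] at ih
      have : 2 * (k + 1) * ((m + 1) * (k + 2)) =
        2 * (k + 1) * (m * (k + 2)) + 2 * ((k + 2) * (k + 1)) := by ring
      omega
  have h1 := key m hm
  obtain ⟨k, rfl⟩ := Nat.exists_eq_add_of_le' hk
  obtain ⟨m, rfl⟩ := Nat.exists_eq_add_of_le' hm
  have e2 : m + 2 - 2 = m := by omega
  have e3 : k + 2 - 1 = k + 1 := by omega
  have e4 : (k + 2) ^ 2 - 1 = (k + 1) * (k + 3) := by
    rw [show (k + 2) ^ 2 = (k + 1) * (k + 3) + 1 by ring, Nat.add_sub_cancel]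
  rw [e3] at h
  rw [e2, e3, e4] at h1
  have h5 : (k + 1) * (2 * (m * (k + 2)) + 2 * (k + 3)) ≤ (k + 1) * (2 * (e * (m + 2) + 1)) := by
    calc _ = 2 * (k + 1) * (m * (k + 2)) + 2 * ((k + 1) * (k + 3)) := by ring
      _ ≤ _ := h1
      _ ≤ 2 * ((k + 1) * (e * (m + 2) + 1)) := by omega
      _ = _ := by ring
  have h6 := Nat.le_of_mul_le_mul_left h5 (by omega)
  have h7 : (2 * e) * (m + 2) ≤ (k + 2) * (m + 2) := Nat.mul_le_mul_right _ hek
  have hm0 : m = 0 := by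
    by_contra hm0
    have : k + 2 ≤ m * (k + 2) := Nat.le_mul_of_pos_left _ (by omega)
    nlinarith
  subst hm0
  constructor
  · rfl
  · omega

theorem eq_of_two_mul_eq_pow {p e : ℕ} (hp : 2 ≤ p) (he : e ≠ 0) (h : p ^ e ≤ 2 * e) :
    p ^ e = 2 * e ∧ (p ^ e = 2 ∨ p ^ e = 4) := by
  have h2 : ∀ e, 3 ≤ e → 2 * e < 2 ^ e := by
    intro e he
    induction e, he using Nat.le_induction with
    | base => norm_num
    | succ m hm ih => rw [pow_succ]; omega
  have hpe : 2 ^ e ≤ p ^ e := Nat.pow_le_pow_left hp e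
  rcases Nat.lt_or_ge e 3 with h3 | h3
  · interval_cases e
    · exact absurd rfl he
    · rw [pow_one] at h ⊢
      omega
    · rw [pow_two] at h ⊢
      have : p = 2 := by nlinarith
      subst this
      decide
  · have := h2 e h3
    omega

theorem two_mul_le_pow {p : ℕ} (hp : 2 ≤ p) (e : ℕ) : 2 * e ≤ p ^ e := by
  refine le_trans ?_ (Nat.pow_le_pow_left hp e)
  induction e with
  | zero => simp
  | succ m ih =>
    have : 1 ≤ 2 ^ m := Nat.one_le_two_pow
    rw [pow_succ]; omega

/-- A subfield containing `r`-th powers, where `r - 1` is at most the number of automorphisms,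
is everything, or has index two and order two or four. -/
theorem subfield_card_of_zpowers_le {ω : Fˣ} (hω : ∀ x : Fˣ, x ∈ Subgroup.zpowers ω) {r : ℕ}
    (hr : 1 < r) (hrq : r ∣ Nat.card F - 1) (hle : r ≤ Nat.card (F ≃+* F) + 1)
    (K : Subfield F) (hK : ∀ c ∈ Subgroup.zpowers (ω ^ r), (c : F) ∈ K) (hKF : K ≠ ⊤) :
    Nat.card F = Nat.card K ^ 2 ∧ r = Nat.card K + 1 ∧ (Nat.card K = 2 ∨ Nat.card K = 4) ∧
      Module.finrank K F = 2 := by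
  have : Fintype K := Fintype.ofFinite K
  obtain ⟨p, e, hp, he, hk⟩ := (isPrimePow_nat_iff _).1 (FiniteField.isPrimePow_card K)
  rw [← Nat.card_eq_fintype_card] at hk
  have : Fact p.Prime := ⟨hp⟩
  have hqk : Nat.card F = Nat.card K ^ Module.finrank K F := Module.natCard_eq_pow_finrank
  set m := Module.finrank K F with hm
  have hm0 : 0 < m := Module.finrank_pos
  have hm1 : m ≠ 1 := by
    intro h1
    rw [h1, pow_one] at hqk
    refine hKF (SetLike.coe_injective ?_)
    rw [Subfield.coe_top]
    exact (Set.eq_univ_iff_ncard _).2 (by rw [← Nat.card_coe_set_eq]; exact hqk.symm)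
  have hk2 : 2 ≤ Nat.card K := Finite.one_lt_card
  -- C embeds in Kˣ.
  have hC : Nat.card (Subgroup.zpowers (ω ^ r)) ≤ Nat.card K - 1 := by
    rw [← Nat.card_units]
    refine Nat.card_le_card_of_injective
      (fun c => Units.mk0 (⟨(c.1 : F), hK c.1 c.2⟩ : K) 
        (fun h => c.1.ne_zero (congrArg Subtype.val h))) ?_
    intro c d h
    exact Subtype.ext (Units.ext (congrArg (fun u : Kˣ => ((u : K) : F)) h))
  have hcard := card_zpowers_pow hω hr hrq
  have hqf : Nat.card F = p ^ (e * m) := by rw [hqk, ← hk, pow_mul]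
  have hrm : r ≤ e * m + 1 := hle.trans (Nat.succ_le_succ (card_ringAut_le hqf))
  have h2e := two_mul_le_pow hp.two_le e
  rw [hk] at h2e
  -- The bound is k^m - 1 = |C| r ≤ (k - 1)(em + 1), where k = |K| = p^e.
  obtain ⟨hm2, hke⟩ := geom_le_imp (m := m) (by omega) h2e hk2 (by
    rw [← hqk, ← hcard]
    exact Nat.mul_le_mul hC hrm)
  have h24 := (eq_of_two_mul_eq_pow hp.two_le he.ne' (by omega)).2
  rw [hk] at h24
  rw [hm2] at hqk hrm
  refine ⟨hqk, ?_, h24, hm2⟩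
  -- This gives r ≥ k + 1; conversely r ≤ 2e + 1 = k + 1.
  have h1 : (Nat.card K - 1) * (Nat.card K + 1) ≤ (Nat.card K - 1) * r := by
    calc _ = Nat.card F - 1 := by
          rw [hqk]
          obtain ⟨k, h⟩ := Nat.exists_eq_add_of_le' hk2
          rw [h, show (k + 2) ^ 2 = (k + 1) * (k + 3) + 1 by ring, Nat.add_sub_cancel]
          rfl
      _ ≤ _ := by rw [← hcard]; exact Nat.mul_le_mul_right _ hC
  have := Nat.le_of_mul_le_mul_left h1 (by omega)
  omega

end FiniteField

/-! ### Subgroups of F ⋊ Fˣ invariant under field automorphisms -/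

section FiniteField

variable {F : Type*} [Field F]

/-- `Q` is (the graph of) a subgroup of `F ⋊ Fˣ` that contains `0 ⋊ C` and is invariant under the
automorphisms in `Δ`. -/
structure IsAffineSubgroup (C : Subgroup Fˣ) (Δ : Set (F ≃+* F)) (Q : F → F → Prop) : Prop where
  ne_zero : ∀ {x y}, Q x y → y ≠ 0
  zero_mem : ∀ c ∈ C, Q 0 (c : F)
  mul_mem : ∀ {t d s e}, Q t d → Q s e → Q (s + t * e) (d * e)
  inv_mem : ∀ {t d}, Q t d → Q (-(t * d⁻¹)) d⁻¹
  map_mem : ∀ τ ∈ Δ, ∀ {x y}, Q x y → Q (τ x) (τ y)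

namespace IsAffineSubgroup

variable {C : Subgroup Fˣ} {Δ : Set (F ≃+* F)} {Q : F → F → Prop} (hQ : IsAffineSubgroup C Δ Q)
include hQ

theorem add_mem {s t : F} (hs : Q s 1) (ht : Q t 1) : Q (s + t) 1 := by
  simpa using hQ.mul_mem ht hs

theorem neg_mem {s : F} (hs : Q s 1) : Q (-s) 1 := by
  simpa using hQ.inv_mem hs

theorem zero_one : Q 0 1 := by
  simpa using hQ.zero_mem 1 (one_mem C)

/-- Conjugating the translation by (s, d) multiplies it by d; hence the whole projection of Q
consists of multipliers. -/
theorem conj_mem {s d t : F} (hs : Q s d) (ht : Q t 1) : Q (t * d) 1 := by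
  have hd := hQ.ne_zero hs
  have := hQ.mul_mem (hQ.inv_mem hs) (hQ.mul_mem ht hs)
  simpa [hd] using this

theorem mul_unit_mem {t d : F} {c : Fˣ} (h : Q t d) (hc : c ∈ C) : Q (t * c) (d * c) := by
  simpa using hQ.mul_mem h (hQ.zero_mem c hc)

theorem translation_mem {t s d : F} (h : Q t d) (h' : Q s d) : Q (t - s) 1 := by
  have hd := hQ.ne_zero h
  have h1 := hQ.mul_mem (hQ.inv_mem h') h
  have h2 : t + -(s * d⁻¹) * d = t - s := by field_simp; ring
  rwa [h2, inv_mul_cancel₀ hd] at h1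

/-- The subfield of multipliers of the translation part. -/
def multiplier [Finite F] : Subfield F where
  carrier := {x | ∀ a, Q a 1 → Q (a * x) 1}
  mul_mem' hx hy a ha := by simpa [mul_assoc] using hy _ (hx a ha)
  one_mem' a ha := by simpa using ha
  add_mem' hx hy a ha := by simpa [mul_add] using hQ.add_mem (hx a ha) (hy a ha)
  zero_mem' a ha := by simpa using hQ.zero_one
  neg_mem' hx a ha := by simpa using hQ.neg_mem (hx a ha)
  inv_mem' := by
    intro x hx a ha
    have : Fintype F := Fintype.ofFinite F
    have hpow : ∀ m : ℕ, Q (a * x ^ m) 1 := by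
      intro m
      induction m with
      | zero => simpa using ha
      | succ m ih => simpa [pow_succ, mul_assoc] using hx _ ih
    by_cases h0 : x = 0
    · simpa [h0] using hQ.zero_one
    -- In a finite field the inverse is a power, so closure under products suffices.
    · have h2 : 2 ≤ Fintype.card F := Fintype.one_lt_card
      have h1 : x ^ (Fintype.card F - 2) = x⁻¹ := by
        apply eq_inv_of_mul_eq_one_left
        rw [← pow_succ, show Fintype.card F - 2 + 1 = Fintype.card F - 1
          by omega, FiniteField.pow_card_sub_one_eq_one x h0]
      rw [← h1]
      exact hpow _

theorem mem_multiplier_of_mem [Finite F] {s d : F} (h : Q s d) : d ∈ hQ.multiplier :=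
  fun _ ha => hQ.conj_mem h ha

/-- The translation part as a vector space over the field of multipliers. -/
def translations [Finite F] : Submodule hQ.multiplier F where
  carrier := {a | Q a 1}
  add_mem' ha hb := hQ.add_mem ha hb
  zero_mem' := hQ.zero_one
  smul_mem' x a ha := by
    rw [Algebra.smul_def, mul_comm]
    exact x.2 a ha

theorem mem_translations [Finite F] {a : F} : a ∈ hQ.translations ↔ Q a 1 := Iff.rfl

theorem eq_zero_or_forall_of_multiplier_eq_top [Finite F] (h : hQ.multiplier = ⊤) :
    (∀ a, Q a 1 → a = 0) ∨ ∀ a, Q a 1 := by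
  by_contra! ⟨⟨a, ha, ha0⟩, b, hb⟩
  have h1 : a⁻¹ * b ∈ hQ.multiplier := by rw [h]; trivial
  have := h1 a ha
  rw [mul_inv_cancel_left₀ ha0] at this
  exact hb this

/-- When the projection is just C, the subgroup 0 ⋊ C of Q splits it as A ⋊ C. -/
theorem iff_of_proj_le (hD : ∀ x y, Q x y → ∃ c ∈ C, y = (c : F)) (x y : F) :
    Q x y ↔ Q x 1 ∧ ∃ c ∈ C, y = (c : F) := by
  constructor
  · intro h
    obtain ⟨c, hc, rfl⟩ := hD x y h
    refine ⟨?_, c, hc, rfl⟩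
    have h1 := hQ.mul_unit_mem h (InvMemClass.inv_mem hc)
    have h2 := hQ.conj_mem (hQ.zero_mem c hc) (by simpa using h1)
    simpa using h2
  · rintro ⟨h, c, hc, rfl⟩
    have h2 := hQ.conj_mem (hQ.zero_mem _ (InvMemClass.inv_mem hc)) h
    simpa using hQ.mul_unit_mem h2 hc

/-- The projection is a Δ-invariant union of cosets of C, so one nontrivial coset brings in all the
others. -/
theorem proj_surjective (hΔ : TransitiveOnCosets Δ C) {x₀ y₀ : F} (h : Q x₀ y₀)
    (hy : ¬ ∃ c ∈ C, y₀ = (c : F)) (y : F) (hy0 : y ≠ 0) : ∃ x, Q x y := by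
  by_cases hyC : ∃ c ∈ C, y = (c : F)
  · obtain ⟨c, hc, rfl⟩ := hyC
    exact ⟨0, hQ.zero_mem c hc⟩
  · obtain ⟨τ, hτ, c, hc, h1⟩ := hΔ (Units.mk0 y₀ (hQ.ne_zero h)) (Units.mk0 y hy0)
      (fun hc => hy ⟨_, hc, rfl⟩) (fun hc => hyC ⟨_, hc, rfl⟩)
    have := hQ.mul_unit_mem (hQ.map_mem τ hτ h) (InvMemClass.inv_mem hc)
    rw [Units.val_mk0, Units.val_mk0] at h1
    rw [h1, mul_assoc, ← Units.val_mul, mul_inv_cancel, Units.val_one, mul_one] at this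
    exact ⟨_, this⟩

/-- A complement of the translation group is conjugate to `0 ⋊ Fˣ`. -/
theorem exists_eq_mul_one_sub (hA : ∀ a, Q a 1 → a = 0) (hD : ∀ y, y ≠ 0 → ∃ x, Q x y)
    {d₀ : F} (h0 : d₀ ≠ 0) (h1 : d₀ ≠ 1) :
    ∃ a, ∀ x y, Q x y ↔ y ≠ 0 ∧ x = a * (1 - y) := by
  have huniq : ∀ {x x' y}, Q x y → Q x' y → x = x' := fun h h' =>
    sub_eq_zero.1 (hA _ (hQ.translation_mem h h'))
  obtain ⟨t, ht⟩ := hD d₀ h0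
  have key : ∀ x y, Q x y → x = t / (1 - d₀) * (1 - y) := by
    intro x y h
    -- With no translations, Q embeds in the abelian group Fˣ; commuting with (t, d₀) determines x
    -- from y.
    have h2 := huniq (hQ.mul_mem ht h) (by simpa [mul_comm] using hQ.mul_mem h ht)
    have h3 : 1 - d₀ ≠ 0 := sub_ne_zero.2 h1.symm
    field_simp
    linear_combination h2
  refine ⟨t / (1 - d₀), fun x y => ⟨fun h => ⟨hQ.ne_zero h, key x y h⟩, ?_⟩⟩
  rintro ⟨hy, rfl⟩
  obtain ⟨x, hx⟩ := hD y hy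
  rwa [← key x y hx]

end IsAffineSubgroup

variable [Finite F]

omit [Finite F] in
/-- Some automorphism in `Δ` is the squaring map modulo `C`. -/
theorem TransitiveOnCosets.exists_sq {Δ : Set (F ≃+* F)} {ω : Fˣ}
    (hω : ∀ x : Fˣ, x ∈ Subgroup.zpowers ω) {r : ℕ} (hr : 2 < r) (hrq : r ∣ Nat.card F - 1)
    (h : TransitiveOnCosets Δ (Subgroup.zpowers (ω ^ r))) :
    ∃ τ ∈ Δ, ∀ a : F, a ≠ 0 → ∃ c ∈ Subgroup.zpowers (ω ^ r), τ a = a ^ 2 * c := by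
  have hmem (m : ℕ) (h0 : m ≠ 0) (h1 : m < r) : ω ^ m ∉ Subgroup.zpowers (ω ^ r) := by
    rw [← zpow_natCast ω m, zpow_mem_zpowers_pow_iff (by rwa [orderOf_generator hω]),
      Int.natCast_dvd_natCast]
    exact fun hd => absurd (Nat.le_of_dvd (by omega) hd) (by omega)
  -- Since r > 2, both ω and ω² lie outside C. As ω generates Fˣ, the effect of τ on ω determines it
  -- modulo C everywhere.
  obtain ⟨τ, hτ, c, hc, h1⟩ := h ω (ω ^ 2) (by simpa using hmem 1 one_ne_zero (by omega))
    (hmem 2 two_ne_zero hr)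
  refine ⟨τ, hτ, fun a ha => ?_⟩
  obtain ⟨i, hi⟩ := hω (Units.mk0 a ha)
  have hi' : a = (ω : F) ^ i := by
    rw [← Units.val_zpow_eq_zpow_val]
    exact (congrArg Units.val hi).symm
  refine ⟨c ^ i, zpow_mem hc i, ?_⟩
  rw [hi', map_zpow₀, h1, mul_zpow]
  push_cast
  rw [← zpow_natCast, ← zpow_natCast, ← zpow_mul, ← zpow_mul, mul_comm i]

theorem card_eq_three_or_four (hq : 3 ≤ Nat.card F)
    (hle : Nat.card F - 1 ≤ Nat.card (F ≃+* F) + 1) : Nat.card F = 3 ∨ Nat.card F = 4 := by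
  have : Fintype F := Fintype.ofFinite F
  obtain ⟨p, e, hp, he, hk⟩ := (isPrimePow_nat_iff _).1 (FiniteField.isPrimePow_card F)
  rw [← Nat.card_eq_fintype_card] at hk
  have : Fact p.Prime := ⟨hp⟩
  have h1 := card_ringAut_le hk.symm
  have h2 : e + 3 ≤ Nat.card F ∨ e ≤ 2 := by
    rcases Nat.lt_or_ge 2 e with h | h
    · left
      have h3 : 2 ^ e ≤ p ^ e := Nat.pow_le_pow_left hp.two_le e
      have h4 : ∀ e, 3 ≤ e → e + 3 ≤ 2 ^ e := by
        intro e he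
        induction e, he using Nat.le_induction with
        | base => norm_num
        | succ m hm ih => rw [pow_succ]; omega
      have := h4 e h
      omega
    · exact Or.inr h
  omega

theorem IsAffineSubgroup.classification {Δ : Set (F ≃+* F)} {ω : Fˣ}
    (hω : ∀ x : Fˣ, x ∈ Subgroup.zpowers ω) {r : ℕ} (hr : 1 < r) (hrq : r ∣ Nat.card F - 1)
    (hΔ : TransitiveOnCosets Δ (Subgroup.zpowers (ω ^ r))) {Q : F → F → Prop}
    (hQ : IsAffineSubgroup (Subgroup.zpowers (ω ^ r)) Δ Q) :
    (∀ x y, Q x y ↔ x = 0 ∧ ∃ c ∈ Subgroup.zpowers (ω ^ r), y = (c : F)) ∨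
    (∀ x y, Q x y ↔ x = 0 ∧ y ≠ 0) ∨
    (∀ x y, Q x y ↔ ∃ c ∈ Subgroup.zpowers (ω ^ r), y = (c : F)) ∨
    (∀ x y, Q x y ↔ y ≠ 0) ∨
    (Nat.card F = 3 ∧ r = 2 ∧ ∃ a ≠ 0, ∀ x y, Q x y ↔ y ≠ 0 ∧ x = a * (1 - y)) ∨
    (Nat.card F = 4 ∧ r = 3 ∧ ∀ x y, Q x y ↔ y ≠ 0 ∧ x = 1 - y) ∨
    (∃ K : Subfield F, Nat.card F = Nat.card K ^ 2 ∧ r = Nat.card K + 1 ∧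
      (Nat.card K = 2 ∨ Nat.card K = 4) ∧
      ∀ x y, Q x y ↔ x ∈ K ∧ ∃ c ∈ Subgroup.zpowers (ω ^ r), y = (c : F)) := by
  have hle := hΔ.le_card hr (by rwa [orderOf_generator hω])
  have hK : ∀ c ∈ Subgroup.zpowers (ω ^ r), (c : F) ∈ hQ.multiplier := fun c hc =>
    hQ.mem_multiplier_of_mem (hQ.zero_mem c hc)
  by_cases hD : ∀ x y, Q x y → ∃ c ∈ Subgroup.zpowers (ω ^ r), y = (c : F)
  · have hiff := hQ.iff_of_proj_le hD
    by_cases htop : hQ.multiplier = ⊤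
    · rcases hQ.eq_zero_or_forall_of_multiplier_eq_top htop with h | h
      · left
        intro x y
        rw [hiff]
        exact and_congr_left fun _ => ⟨h x, fun h => h ▸ hQ.zero_one⟩
      · right; right; left
        intro x y
        rw [hiff]
        exact and_iff_right (h x)
    · obtain ⟨h1, h2, h3, h4⟩ := subfield_card_of_zpowers_le hω hr hrq hle hQ.multiplier hK htop
      refine .inr <| .inr <| .inr <| .inr <| .inr <| .inr ⟨hQ.multiplier, h1, h2, h3, ?_⟩
      -- If A were 0 or F, every element of F would be a multiplier. So A is a line in the
      -- two-dimensional K-space F.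
      have hA0 : hQ.translations ≠ ⊥ := by
        intro h
        refine htop (eq_top_iff.2 fun x _ a ha => ?_)
        have : a = 0 := by
          rw [← hQ.mem_translations, h] at ha
          exact ha
        simpa [this] using hQ.zero_one
      have hA1 : hQ.translations ≠ ⊤ := by
        intro h
        refine htop (eq_top_iff.2 fun x _ a ha => ?_)
        rw [← hQ.mem_translations, h]
        trivial
      have hfr : Module.finrank hQ.multiplier hQ.translations = 1 := by
        have := Submodule.finrank_lt hA1
        have : Module.finrank hQ.multiplier hQ.translations ≠ 0 := by
          rwa [Ne, Submodule.finrank_eq_zero]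
        omega
      obtain ⟨a, ha, ha0⟩ := Submodule.exists_mem_ne_zero_of_ne_bot hA0
      have hspan : ∀ b, Q b 1 → ∃ k ∈ hQ.multiplier, b = k * a := by
        intro b hb
        obtain ⟨k, hk⟩ := (finrank_eq_one_iff_of_nonzero' (⟨a, ha⟩ : hQ.translations)
          (by simpa [Subtype.ext_iff] using ha0)).1 hfr ⟨b, hb⟩
        exact ⟨k, k.2, (congrArg Subtype.val hk).symm⟩
      obtain ⟨τ, hτ, hsq⟩ := hΔ.exists_sq hω (by omega) hrq
      obtain ⟨c, hc, hac⟩ := hsq a ha0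
      -- A = Ka contains τ a = a² c with c ∈ C ⊆ K, and cancelling a gives a ∈ K.
      have haK : a ∈ hQ.multiplier := by
        obtain ⟨k, hk, h5⟩ := hspan (τ a) (by simpa using hQ.map_mem τ hτ ha)
        have h6 : a = k * (c : F)⁻¹ := by
          rw [eq_mul_inv_iff_mul_eq₀ c.ne_zero]
          apply mul_right_cancel₀ ha0
          rw [← h5, hac]
          ring
        rw [h6]
        exact MulMemClass.mul_mem hk (InvMemClass.inv_mem (hK c hc))
      intro x y
      rw [hiff]
      refine and_congr_left fun _ => ⟨fun hx => ?_, fun hx => ?_⟩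
      · obtain ⟨k, hk, rfl⟩ := hspan x hx
        exact MulMemClass.mul_mem hk haK
      · have := (MulMemClass.mul_mem (InvMemClass.inv_mem haK) hx : a⁻¹ * x ∈ hQ.multiplier) a ha
        rwa [mul_inv_cancel_left₀ ha0] at this
  · push Not at hD
    obtain ⟨x₀, y₀, h0, hy0⟩ := hD
    have hsurj := hQ.proj_surjective hΔ h0 (by push Not; exact hy0)
    have htop : hQ.multiplier = ⊤ := by
      refine eq_top_iff.2 fun x _ => ?_
      by_cases hx : x = 0
      · rw [hx]; exact ZeroMemClass.zero_mem _
      · obtain ⟨s, hs⟩ := hsurj x hx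
        exact hQ.mem_multiplier_of_mem hs
    rcases hQ.eq_zero_or_forall_of_multiplier_eq_top htop with h | h
    · obtain ⟨a, ha⟩ := hQ.exists_eq_mul_one_sub h hsurj (hQ.ne_zero h0)
        (fun h => hy0 1 (one_mem _) (by simpa using h))
      by_cases ha0 : a = 0
      · right; left
        intro x y
        rw [ha, ha0, zero_mul, and_comm]
      -- For c ∈ C, the pair (0, c) lies in Q, so a(1 - c) = 0.
      have hC : ∀ c ∈ Subgroup.zpowers (ω ^ r), c = 1 := by
        intro c hc
        have := ((ha _ _).1 (hQ.zero_mem c hc)).2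
        have := (mul_eq_zero.1 this.symm).resolve_left ha0
        ext
        exact (sub_eq_zero.1 this).symm
      have hrcard : r = Nat.card F - 1 := by
        have h1 := card_zpowers_pow hω hr hrq
        have h2 : Nat.card (Subgroup.zpowers (ω ^ r)) = 1 := by
          rw [Subgroup.card_eq_one, eq_bot_iff]
          exact hC
        rwa [h2, one_mul] at h1
      rcases card_eq_three_or_four (F := F) (by omega) (by omega) with h3 | h4
      · exact .inr <| .inr <| .inr <| .inr <| .inl ⟨h3, by omega, a, ha0, ha⟩
      · refine .inr <| .inr <| .inr <| .inr <| .inr <| .inl ⟨h4, by omega, ?_⟩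
        obtain ⟨τ, hτ, hsq⟩ := hΔ.exists_sq hω (by omega) hrq
        have hsq' : ∀ b, b ≠ 0 → τ b = b ^ 2 := by
          intro b hb
          obtain ⟨c, hc, h5⟩ := hsq b hb
          rw [h5, hC c hc, Units.val_one, mul_one]
        -- Applying the squaring automorphism to a point of the complement replaces a by a², so a² =
        -- a.
        have h6 := hQ.map_mem τ hτ ((ha _ _).2 ⟨hQ.ne_zero h0, rfl⟩)
        have h7 := ((ha _ _).1 h6).2
        have hy1 : 1 - y₀ ≠ 0 := by
          rw [sub_ne_zero]
          exact fun h => hy0 1 (one_mem _) (by simpa using h.symm)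
        have h8 : 1 - τ y₀ ≠ 0 := by
          rw [← map_one τ, ← map_sub]
          exact (map_ne_zero τ).2 hy1
        have h9 : a = 1 := by
          rw [map_mul, map_sub, map_one] at h7
          have h10 := mul_right_cancel₀ h8 h7
          rw [hsq' a ha0] at h10
          apply mul_right_cancel₀ ha0
          rw [← pow_two, h10, one_mul]
        intro x y
        rw [ha, h9, one_mul]
    · right; right; right; left
      intro x y
      refine ⟨hQ.ne_zero, fun hy => ?_⟩
      obtain ⟨s, hs⟩ := hsurj y hy
      have := hQ.mul_mem (h ((x - s) * y⁻¹)) hs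
      rw [inv_mul_cancel_right₀ hy, one_mul, add_sub_cancel] at this
      exact this

end FiniteField

/-! ### Transvections fixing a vector -/

section Transvections

variable {F V : Type*} [Field F] [AddCommGroup V] [Module F V]

theorem exists_dual_of_notMem_span {s : Set V} {u : V} (h : u ∉ Submodule.span F s) :
    ∃ φ : Module.Dual F V, φ u = 1 ∧ ∀ x ∈ s, φ x = 0 := by
  obtain ⟨φ, h1, h2⟩ := Submodule.exists_le_ker_of_notMem h
  refine ⟨(φ u)⁻¹ • φ, by simp [h1], fun x hx => ?_⟩
  have : φ x = 0 := h2 (Submodule.subset_span hx)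
  simp [this]

theorem exists_dual_eq_one {e u w : V} (hu : u ∉ Submodule.span F {e})
    (hw : w ∉ Submodule.span F {e, u}) :
    ∃ φ : Module.Dual F V, φ e = 0 ∧ φ u = 1 ∧ φ w = 1 := by
  obtain ⟨f, hf, hf'⟩ := exists_dual_of_notMem_span hu
  obtain ⟨g, hg, hg'⟩ := exists_dual_of_notMem_span hw
  have h1 := hf' e rfl
  have h2 := hg' e (by simp)
  have h3 := hg' u (by simp)
  exact ⟨f + (1 - f w) • g, by simp [h1, h2], by simp [hf, h3], by simp [hg]⟩

/-- If the set `S` has the block property for transvections that fix `e`, then it is contained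
in a plane through `e` or it contains all vectors outside `⟨e⟩`. -/
theorem mem_of_transvection_block {S : Set V} {e a b : V}
    (hS : ∀ (φ : Module.Dual F V) (w : V), φ e = 0 → φ w = 0 →
      (∃ x ∈ S, x + φ x • w ∈ S) → ∀ x ∈ S, x + φ x • w ∈ S)
    (ha : a ∈ S) (hb : b ∈ S) (hae : a ∉ Submodule.span F {e})
    (hbe : b ∉ Submodule.span F {e, a}) {u : V} (hu : u ∉ Submodule.span F {e}) : u ∈ S := by
  have key : ∀ a ∈ S, ∀ b ∈ S, ∀ f g : Module.Dual F V, f e = 0 → f a = 1 → f b = 0 → g e = 0 →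
      g a = 0 → g b = 1 → ∀ x y z : F, z ≠ 0 → x • e + y • a + z • b ∈ S := by
    intro a ha b hb f g fe fa fb ge ga gb x y z hz
    -- Two transvections suffice: one fixes a and moves b to b + k a; the next fixes b + k a and
    -- moves a to the target. Matching the coefficient of a requires 1 + z k = y.
    obtain ⟨k, hk⟩ : ∃ k, z * k = y - 1 := ⟨(y - 1) / z, by field_simp⟩
    have h1 : b + k • a ∈ S := by
      simpa [gb] using hS g (k • a) ge (by simp [ga]) ⟨a, ha, by simpa [ga] using ha⟩ b hb
    have h2 := hS (f - k • g) (x • e + z • (b + k • a)) (by simp [fe, ge])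
      (by simp [fe, ge, fa, fb, ga, gb]; ring) ⟨_, h1, by simpa [fe, ge, fa, fb, ga, gb] using h1⟩ a ha
    have h3 : (f - k • g) a = 1 := by simp [fa, ga]
    rw [h3] at h2
    have h4 : x • e + y • a + z • b = a + (1 : F) • (x • e + z • (b + k • a)) := by
      rw [show y = 1 + z * k by rw [hk]; ring]
      module
    rwa [h4]
  obtain ⟨g, gb, hg⟩ := exists_dual_of_notMem_span hbe
  obtain ⟨f₀, fa, hf⟩ := exists_dual_of_notMem_span hae
  have ge := hg e (by simp)
  have ga := hg a (by simp)
  have fe := hf e rfl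
  by_cases hspan : u ∈ Submodule.span F {e, a, b}
  · obtain ⟨x, y, z, rfl⟩ := Submodule.mem_span_triple.1 hspan
    by_cases hz : z = 0
    · have hy : y ≠ 0 := by
        rintro rfl
        refine hu (Submodule.mem_span_singleton.2 ⟨x, ?_⟩)
        simp [hz]
      have := key b hb a ha g (f₀ - f₀ b • g) ge gb ga (by simp [fe, ge]) (by simp [gb])
        (by simp [fa, ga]) x z y hy
      rwa [add_right_comm] at this
    · exact key a ha b hb (f₀ - f₀ b • g) g (by simp [fe, ge]) (by simp [fa, ga]) (by simp [gb])
        ge ga gb x y z hz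
  -- Outside the span of e, a, b, a single transvection fixing e and a moves b to u.
  · obtain ⟨φ, φu, hφ⟩ := exists_dual_of_notMem_span hspan
    have φe := hφ e (by simp)
    have φa := hφ a (by simp)
    have φb := hφ b (by simp)
    have h1 : ((1 - g u) • φ + g) b = 1 := by simp [φb, gb]
    have h2 : ((1 - g u) • φ + g) u = 1 := by simp [φu]
    have := hS ((1 - g u) • φ + g) (u - b) (by simp [φe, ge]) (by rw [map_sub, h1, h2, sub_self])
      ⟨a, ha, by simpa [φa, ga] using ha⟩ b hb
    rwa [h1, one_smul, add_sub_cancel] at this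

variable {n : ℕ}

/-- A linear automorphism of `F ^ n` as an element of `ΓL_n(F)`. -/
def linearMem (f : (Fin n → F) ≃ₗ[F] (Fin n → F)) : GammaL F n :=
  ⟨f.toEquiv, f.map_add, RingEquiv.refl F, f.map_smul⟩

theorem linearMem_mem_SL {f : (Fin n → F) ≃ₗ[F] (Fin n → F)}
    (hf : LinearMap.det (f : (Fin n → F) →ₗ[F] (Fin n → F)) = 1) : linearMem f ∈ SL F n := by
  refine ⟨⟨(LinearMap.toMatrix' (f : (Fin n → F) →ₗ[F] (Fin n → F))).transpose, ?_⟩, fun v => ?_⟩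
  · rw [Matrix.det_transpose, LinearMap.det_toMatrix', hf]
  · rw [Matrix.vecMul_transpose, ← Matrix.toLin'_apply, Matrix.toLin'_toMatrix']
    rfl

theorem exists_SL_transvection {φ : Module.Dual F (Fin n → F)} {w : Fin n → F} (h : φ w = 0) :
    ∃ g ∈ SL F n, ∀ x, g.1 x = x + φ x • w := by
  refine ⟨linearMem (LinearEquiv.transvection h), linearMem_mem_SL ?_, fun x => ?_⟩
  · rw [LinearEquiv.transvection.coe_toLinearMap, LinearMap.transvection.det, h, add_zero]
  · exact LinearEquiv.transvection.apply h x

/-- The stabiliser in `SL_n(F)` of a nonzero vector `e` is transitive on the vectors outside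
`⟨e⟩`. -/
theorem exists_SL_map_eq (hn : 3 ≤ n) {e u w : Fin n → F} (hu : u ∉ Submodule.span F {e})
    (hw : w ∉ Submodule.span F {e}) : ∃ g ∈ SL F n, g.1 e = e ∧ g.1 u = w := by
  have key : ∀ u w : Fin n → F, u ∉ Submodule.span F {e} → w ∉ Submodule.span F {e, u} →
      ∃ g ∈ SL F n, g.1 e = e ∧ g.1 u = w := by
    intro u w hu hw
    obtain ⟨φ, h1, h2, h3⟩ := exists_dual_eq_one hu hw
    obtain ⟨g, hg, hg'⟩ := exists_SL_transvection (φ := φ) (w := w - u) (by simp [h2, h3])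
    exact ⟨g, hg, by simp [hg', h1], by simp [hg', h2]⟩
  by_cases hwu : w ∈ Submodule.span F {e, u}
  · classical
    -- For dependent e, u, w, pass through a vector z outside ⟨e, u⟩, which exists because n ≥ 3.
    obtain ⟨z, hz⟩ : ∃ z, z ∉ Submodule.span F {e, u} := by
      by_contra! h
      have h1 : Submodule.span F {e, u} = ⊤ := Submodule.eq_top_iff'.2 h
      have h2 := finrank_span_finset_le_card (R := F) ({e, u} : Finset (Fin n → F))
      rw [Finset.coe_pair, Set.finrank, h1, finrank_top, Module.finrank_fin_fun] at h2
      have h3 := Finset.card_le_two (a := e) (b := u)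
      omega
    obtain ⟨g, hg, hge, hgu⟩ := key u z hu hz
    obtain ⟨g', hg', hge', hgu'⟩ := key z w
      (fun h => hz (Submodule.span_mono (by simp) h)) (fun h => hz <| by
        rw [Set.pair_comm] at h
        have h1 := mem_span_insert_exchange h hw
        refine Submodule.span_le.2 ?_ h1
        rintro x (rfl | rfl)
        · exact hwu
        · exact Submodule.subset_span (by simp))
    exact ⟨g' * g, mul_mem hg' hg, by simp [hge, hge'], by simp [hgu, hgu']⟩
  · exact key u w hu hwu

end Transvections

/-! ### Points as rays, blocks as sets of vectors, and the rank 3 condition -/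

section Rays

variable {F : Type*} [Field F] {ω : Fˣ} {r n : ℕ}

theorem mem_ray_self (u : Fin n → F) : u ∈ ray ω r u := ⟨1, one_mem _, by simp⟩

theorem ray_smul {c : Fˣ} (hc : c ∈ Subgroup.zpowers (ω ^ r)) (u : Fin n → F) :
    ray ω r ((c : F) • u) = ray ω r u := by
  ext v
  constructor
  · rintro ⟨d, hd, rfl⟩
    exact ⟨d * c, mul_mem hd hc, by simp [mul_smul]⟩
  · rintro ⟨d, hd, rfl⟩
    exact ⟨d * c⁻¹, mul_mem hd (inv_mem hc), by simp [smul_smul]⟩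

theorem ray_eq_iff {u v : Fin n → F} :
    ray ω r u = ray ω r v ↔ ∃ c ∈ Subgroup.zpowers (ω ^ r), u = (c : F) • v := by
  constructor
  · intro h
    have := mem_ray_self (ω := ω) (r := r) u
    rwa [h] at this
  · rintro ⟨c, hc, rfl⟩
    exact ray_smul hc v

/-- The set of all vectors on the rays in `B`. -/
def vectors (B : Set (Omega ω r n)) : Set (Fin n → F) := {v | ∃ x ∈ B, x.1 = ray ω r v}

theorem ne_zero_of_val_eq_ray {x : Omega ω r n} {v : Fin n → F} (h : x.1 = ray ω r v) : v ≠ 0 := by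
  rintro rfl
  obtain ⟨u, hu, hx⟩ := x.2
  have := mem_ray_self (ω := ω) (r := r) u
  rw [← hx, h] at this
  obtain ⟨c, -, hc⟩ := this
  exact hu (by simpa using hc)

theorem mem_vectors_iff {B : Set (Omega ω r n)} {x : Omega ω r n} {v : Fin n → F}
    (h : x.1 = ray ω r v) : v ∈ vectors B ↔ x ∈ B := by
  constructor
  · rintro ⟨y, hy, hyv⟩
    rwa [Subtype.ext (h.trans hyv.symm)]
  · exact fun hx => ⟨x, hx, h⟩

theorem smul_mem_vectors_iff {B : Set (Omega ω r n)} {c : Fˣ}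
    (hc : c ∈ Subgroup.zpowers (ω ^ r)) {v : Fin n → F} :
    (c : F) • v ∈ vectors B ↔ v ∈ vectors B := by
  simp only [vectors, Set.mem_ofPred_eq, ray_smul hc]

theorem eq_points {B : Set (Omega ω r n)} {T : Set (Fin n → F)} (hT : T ⊆ vectors B)
    (hB : ∀ u ∈ vectors B, ∃ c ∈ Subgroup.zpowers (ω ^ r), ∃ v ∈ T, u = (c : F) • v) :
    B = points ω r T := by
  ext x
  constructor
  · intro hx
    obtain ⟨u, -, hxu⟩ := x.2
    obtain ⟨c, hc, v, hv, rfl⟩ := hB u ((mem_vectors_iff hxu).2 hx)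
    exact ⟨v, hv, by rw [hxu, ray_smul hc]⟩
  · rintro ⟨v, hv, hxv⟩
    exact (mem_vectors_iff hxv).1 (hT hv)

/-- C acts freely on nonzero vectors, so each point carries |C| of them; block sizes can then be
read off from coordinates. -/
theorem ncard_mul_card (B : Set (Omega ω r n)) :
    B.ncard * Nat.card (Subgroup.zpowers (ω ^ r)) = (vectors B).ncard := by
  choose u hu hxu using fun x : Omega ω r n => x.2
  rw [← Nat.card_coe_set_eq, ← Nat.card_coe_set_eq, ← Nat.card_prod]
  refine Nat.card_congr (Equiv.ofBijective (fun p => ⟨(p.2.1 : F) • u p.1.1,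
    (smul_mem_vectors_iff p.2.2).2 ((mem_vectors_iff (hxu _)).2 p.1.2)⟩) ⟨?_, ?_⟩)
  · rintro ⟨⟨x, hx⟩, c, hc⟩ ⟨⟨y, hy⟩, d, hd⟩ h
    have h1 : (c : F) • u x = (d : F) • u y := congrArg Subtype.val h
    have hxy : x = y := by
      apply Subtype.ext
      rw [hxu x, hxu y, ← ray_smul hc, h1, ray_smul hd]
    subst hxy
    have := smul_left_injective F (hu x) h1
    simpa [Units.ext_iff] using this
  · rintro ⟨v, x, hx, hxv⟩
    obtain ⟨c, hc, hcv⟩ := ray_eq_iff.1 (hxv.symm.trans (hxu x))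
    exact ⟨⟨⟨x, hx⟩, c, hc⟩, Subtype.ext hcv.symm⟩

theorem mem_sigma_iff (hω : ∀ x : Fˣ, x ∈ Subgroup.zpowers ω) (hr : 1 < r) {e : Fin n → F}
    {x : Omega ω r n} {v : Fin n → F} (h : x.1 = ray ω r v) :
    x ∈ sigma ω r e ↔ v ∈ Submodule.span F {e} := by
  rw [Submodule.mem_span_singleton]
  constructor
  · rintro ⟨_, ⟨i, -, rfl⟩, hx⟩
    obtain ⟨c, -, rfl⟩ := ray_eq_iff.1 (h.symm.trans hx)
    exact ⟨_, mul_smul _ _ _⟩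
  · rintro ⟨l, rfl⟩
    have hl : l ≠ 0 := fun h0 => ne_zero_of_val_eq_ray h (by simp [h0])
    obtain ⟨m, hm⟩ := hω (Units.mk0 l hl)
    have hm' : ω ^ m = Units.mk0 l hl := hm
    have h0 : (0 : ℤ) < r := by omega
    have h1 := Int.emod_nonneg m h0.ne'
    have h2 := Int.emod_lt_of_pos m h0
    refine ⟨_, ⟨(m % r).toNat, by omega, rfl⟩, h.trans (ray_eq_iff.2 ⟨(ω ^ r) ^ (m / r),
      Subgroup.zpow_mem_zpowers _ _, ?_⟩)⟩
    rw [smul_smul, ← Units.val_mul, ← zpow_natCast ω (m % r).toNat, Int.toNat_of_nonneg h1, ← zpow_natCast ω r,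
      ← zpow_mul, ← zpow_add, Int.mul_ediv_add_emod, hm', Units.val_mk0]

variable [Finite F]

theorem smul_val (g : GammaL F n) {x : Omega ω r n} {v : Fin n → F} (h : x.1 = ray ω r v) :
    (g • x).1 = ray ω r (g.1 v) := by
  rw [← image_ray, ← h]
  rfl

theorem mem_stabilizer_iff_exists {G : Subgroup (GammaL F n)} {g : G} {x : Omega ω r n}
    {v : Fin n → F} (h : x.1 = ray ω r v) :
    g ∈ stabilizer G x ↔ ∃ c ∈ Subgroup.zpowers (ω ^ r), g.1.1 v = (c : F) • v := by
  rw [mem_stabilizer_iff, ← ray_eq_iff, ← smul_val g.1 h, ← h]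
  exact ⟨fun hg => congrArg Subtype.val hg, fun hg => Subtype.ext hg⟩

theorem IsBlock.map_mem_vectors {G : Subgroup (GammaL F n)} {α : Omega ω r n} {e : Fin n → F}
    (hα : α.1 = ray ω r e) {B : Set (Omega ω r n)} (hB : IsBlock (stabilizer G α) B)
    {g : GammaL F n} (hg : g ∈ G) (hge : g.1 e = e) {x : Fin n → F} (hx : x ∈ vectors B)
    (hgx : g.1 x ∈ vectors B) {y : Fin n → F} (hy : y ∈ vectors B) : g.1 y ∈ vectors B := by
  have hs : (⟨g, hg⟩ : G) ∈ stabilizer G α :=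
    (mem_stabilizer_iff_exists hα).2 ⟨1, one_mem _, by simpa using hge⟩
  obtain ⟨p, hp, hpx⟩ := hx
  obtain ⟨p', hp', hpy⟩ := hy
  have h1 : (⟨⟨g, hg⟩, hs⟩ : stabilizer G α) • p ∈ B := (mem_vectors_iff (smul_val g hpx)).1 hgx
  have h2 := isBlock_iff_smul_eq_of_mem.1 hB hp h1
  have h3 : (⟨⟨g, hg⟩, hs⟩ : stabilizer G α) • p' ∈ B := h2 ▸ Set.smul_mem_smul_set hp'
  exact (mem_vectors_iff (smul_val g hpy)).2 h3

/-- The automorphisms induced by the elements of `G` that fix `e`. -/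
def inducedAut (G : Subgroup (GammaL F n)) (e : Fin n → F) : Set (F ≃+* F) :=
  {τ | ∃ g ∈ G, g.1 e = e ∧ ∀ (c : F) (v : Fin n → F), g.1 (c • v) = τ c • g.1 v}

/-- In a group of rank three, the stabiliser of `⟨ω ^ r⟩ e` is transitive on the other points of
`⟨e⟩`. -/
theorem HasRankThree.transitiveOnCosets {G : Subgroup (GammaL F n)} (hY : Y ω r n ≤ G)
    (hrank : HasRankThree G (Omega ω r n)) {e u : Fin n → F} (he : e ≠ 0)
    (hu : u ∉ Submodule.span F {e}) :
    TransitiveOnCosets (inducedAut G e) (Subgroup.zpowers (ω ^ r)) := by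
  intro i j hi hj
  let pt (v : Fin n → F) (hv : v ≠ 0) : Omega ω r n := ⟨ray ω r v, v, hv, rfl⟩
  have hu0 : u ≠ 0 := fun h => hu (h ▸ zero_mem _)
  have hne (k : Fˣ) : (k : F) • e ≠ 0 := smul_ne_zero k.ne_zero he
  let α := pt e he
  have hαe : α.1 = ray ω r e := rfl
  let q (x : Omega ω r n) : orbitRel.Quotient (stabilizer G α) (Omega ω r n) := Quotient.mk'' x
  have hq (x y : Omega ω r n) (h : q x = q y) : ∃ g : stabilizer G α, g • y = x :=
    Quotient.eq''.1 h
  have h1 (k : Fˣ) (hk : k ∉ Subgroup.zpowers (ω ^ r)) : q (pt ((k : F) • e) (hne k)) ≠ q α := by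
    intro h
    obtain ⟨g, hg⟩ := hq _ _ h
    have h2 : α = pt ((k : F) • e) (hne k) := (mem_stabilizer_iff.1 g.2).symm.trans hg
    obtain ⟨c, hc, hce⟩ := ray_eq_iff.1 (congrArg Subtype.val h2).symm
    have := smul_left_injective F he hce
    rw [Units.ext this] at hk
    exact hk hc
  have h2 (k : Fˣ) : q (pt u hu0) ≠ q (pt ((k : F) • e) (hne k)) := by
    intro h
    obtain ⟨g, hg⟩ := hq _ _ h
    obtain ⟨c, -, hc⟩ := (mem_stabilizer_iff_exists hαe).1 g.2
    obtain ⟨-, τ, hτ⟩ := g.1.1.2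
    have h3 := smul_val g.1.1 (x := pt ((k : F) • e) (hne k)) rfl
    rw [hτ, hc] at h3
    obtain ⟨d, -, hd⟩ := ray_eq_iff.1 ((congrArg Subtype.val hg).symm.trans h3)
    rw [hd, smul_smul, smul_smul] at hu
    exact hu (Submodule.smul_mem _ _ (Submodule.mem_span_singleton_self e))
  have h3 : q (pt ((j : F) • e) (hne j)) = q (pt ((i : F) • e) (hne i)) := by
    by_contra h
    have hcard := hrank.2 α
    have hfin := Nat.finite_of_card_ne_zero (hcard.trans_ne three_ne_zero)
    let _ := Fintype.ofFinite (orbitRel.Quotient (stabilizer G α) (Omega ω r n))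
    have h4 := h2 1
    have h5 : pt (((1 : Fˣ) : F) • e) (hne 1) = α := Subtype.ext (by simp [pt, α])
    rw [h5] at h4
    -- If i e and j e were in different orbits, then α, these two points and a point outside ⟨e⟩
    -- would represent four orbits.
    have hnd : [q (pt u hu0), q (pt ((j : F) • e) (hne j)), q (pt ((i : F) • e) (hne i)),
        q α].Nodup := by
      simp only [List.nodup_cons, List.mem_cons, List.not_mem_nil, or_false, not_or]
      exact ⟨⟨h2 j, h2 i, h4⟩, ⟨h, h1 j hj⟩, h1 i hi, not_false, List.nodup_nil⟩
    have := hnd.length_le_card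
    rw [← Nat.card_eq_fintype_card, hcard] at this
    simp at this
  obtain ⟨g, hg⟩ := hq _ _ h3
  obtain ⟨c, hc, hce⟩ := (mem_stabilizer_iff_exists hαe).1 g.2
  obtain ⟨-, τ, hτ⟩ := g.1.1.2
  have h4 := smul_val g.1.1 (x := pt ((i : F) • e) (hne i)) rfl
  rw [hτ, hce] at h4
  obtain ⟨d, hd, hde⟩ := ray_eq_iff.1 (h4.symm.trans (congrArg Subtype.val hg))
  rw [smul_smul, smul_smul] at hde
  have h5 := smul_left_injective F he hde
  refine ⟨τ, ?_, d * c⁻¹, mul_mem hd (inv_mem hc), ?_⟩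
  -- The element found fixes only the ray of e; a scalar in Y corrects it to fix e without changing
  -- τ.
  · let y : GammaL F n := linearMem (LinearEquiv.smulOfUnit c⁻¹)
    have hy (v : Fin n → F) : y.1 v = ((c⁻¹ : Fˣ) : F) • v := rfl
    refine ⟨y * g.1.1, mul_mem (hY ⟨c⁻¹, inv_mem hc, hy⟩) g.1.2, ?_, fun k v => ?_⟩
    · change y.1 (g.1.1.1 e) = e
      rw [hy, hce, smul_smul, ← Units.val_mul, inv_mul_cancel, Units.val_one, one_smul]
    · change y.1 (g.1.1.1 (k • v)) = τ k • y.1 (g.1.1.1 v)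
      rw [hy, hy, hτ, smul_comm]
  · push_cast
    field_simp
    linear_combination h5

end Rays

/-! ### Coordinates in the plane ⟨e₁, e₂⟩ -/

section Plane

variable {F : Type*} [Field F] {n : ℕ}

theorem SL_map_add_smul {g : GammaL F n} (hg : g ∈ SL F n) (x y : F) (u v : Fin n → F) :
    g.1 (x • u + y • v) = x • g.1 u + y • g.1 v := by
  obtain ⟨A, hA⟩ := hg
  simp only [hA, Matrix.add_vecMul, Matrix.smul_vecMul]

theorem add_smul_notMem_span {e₁ e₂ : Fin n → F} (he : e₂ ∉ Submodule.span F {e₁}) (x : F) {y : F}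
    (hy : y ≠ 0) : x • e₁ + y • e₂ ∉ Submodule.span F {e₁} := by
  intro h
  have h1 := (Submodule.add_mem_iff_right _
    (Submodule.smul_mem _ x (Submodule.mem_span_singleton_self e₁))).1 h
  exact he ((Submodule.smul_mem_iff _ hy).1 h1)

theorem add_smul_injective {e₁ e₂ : Fin n → F} (he₁ : e₁ ≠ 0) (he : e₂ ∉ Submodule.span F {e₁}) :
    Function.Injective fun p : F × F => p.1 • e₁ + p.2 • e₂ := by
  rintro ⟨x, y⟩ ⟨x', y'⟩ h
  have h1 : (x - x') • e₁ + (y - y') • e₂ = 0 := by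
    have h' : x • e₁ + y • e₂ = x' • e₁ + y' • e₂ := h
    rw [sub_smul, sub_smul, sub_add_sub_comm, h', sub_self]
  have hy : y - y' = 0 := by
    by_contra hy
    have := add_smul_notMem_span he (x - x') hy
    rw [h1] at this
    exact this (zero_mem _)
  have hx : x - x' = 0 := by
    rw [hy, zero_smul, add_zero] at h1
    exact (smul_eq_zero.1 h1).resolve_right he₁
  rw [sub_eq_zero.1 hx, sub_eq_zero.1 hy]

variable [Finite F] {ω : Fˣ} {r : ℕ}

/-- If t e₁ + d e₂ lies on B, an element of SL_n fixing e₁ and sending e₂ there maps B to itself by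
the block property. Its action on the plane is multiplication by (t, d). -/
theorem isAffineSubgroup_vectors (hn : 3 ≤ n) {G : Subgroup (GammaL F n)} (hSL : SL F n ≤ G)
    {α : Omega ω r n} {e₁ e₂ : Fin n → F} (he : e₂ ∉ Submodule.span F {e₁})
    (hα : α.1 = ray ω r e₁) {B : Set (Omega ω r n)} (hB : IsBlock (stabilizer G α) B)
    (hBe : ∀ v ∈ vectors B, v ∉ Submodule.span F {e₁}) (he₂ : e₂ ∈ vectors B) :
    IsAffineSubgroup (Subgroup.zpowers (ω ^ r)) (inducedAut G e₁)
      fun x y => x • e₁ + y • e₂ ∈ vectors B := by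
  have hne {x y : F} (h : x • e₁ + y • e₂ ∈ vectors B) : y ≠ 0 := by
    rintro rfl
    refine hBe _ h ?_
    simpa using Submodule.smul_mem _ x (Submodule.mem_span_singleton_self e₁)
  refine ⟨hne, fun c hc => ?_, fun {t d s y} h h' => ?_, fun {t d} h => ?_,
    fun τ hτ {x y} h => ?_⟩
  · simpa [smul_mem_vectors_iff hc] using he₂
  · obtain ⟨g, hg, hge, hgu⟩ := exists_SL_map_eq hn he (add_smul_notMem_span he t (hne h))
    have := IsBlock.map_mem_vectors hα hB (hSL hg) hge he₂ (hgu ▸ h) h'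
    rw [SL_map_add_smul hg, hge, hgu] at this
    convert this using 1
    module
  · have hd := hne h
    obtain ⟨g, hg, hge, hgu⟩ := exists_SL_map_eq hn (add_smul_notMem_span he t hd) he
    have := IsBlock.map_mem_vectors hα hB (hSL hg) hge h (hgu.symm ▸ he₂) he₂
    rw [SL_map_add_smul hg, hge] at hgu
    convert this using 1
    apply smul_right_injective _ hd
    change d • (-(t * d⁻¹) • e₁ + d⁻¹ • e₂) = d • g.1 e₂
    rw [eq_sub_of_add_eq' hgu, smul_add, smul_smul, smul_smul, mul_inv_cancel₀ hd, mul_neg,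
      mul_left_comm, mul_inv_cancel₀ hd, mul_one, one_smul, neg_smul, neg_add_eq_sub]
  · obtain ⟨g, hg, hge, hτ⟩ := hτ
    have hge₂ : g.1 e₂ ∉ Submodule.span F {e₁} := by
      intro h
      obtain ⟨k, hk⟩ := Submodule.mem_span_singleton.1 h
      refine he (Submodule.mem_span_singleton.2 ⟨τ.symm k, g.1.injective ?_⟩)
      rw [hτ, hge, RingEquiv.apply_symm_apply, hk]
    -- Correcting g by an element of SL_n gives a map that fixes e₁ and e₂ and acts on coordinates
    -- as τ.
    obtain ⟨f, hf, hfe, hfu⟩ := exists_SL_map_eq hn hge₂ he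
    have h1 : (f * g).1 e₁ = e₁ := (congrArg f.1 hge).trans hfe
    have h2 : (f * g).1 e₂ = e₂ := hfu
    have h3 := IsBlock.map_mem_vectors hα hB (mul_mem (hSL hf) hg) h1 he₂ (h2.symm ▸ he₂) h
    have h4 : (f * g).1 (x • e₁ + y • e₂) = f.1 (τ x • g.1 e₁ + τ y • g.1 e₂) := by
      rw [← hτ, ← hτ, ← g.2.1]
      rfl
    rwa [h4, SL_map_add_smul hf, hge, hfe, hfu] at h3

theorem IsBlock.vectors_subset_span_or {G : Subgroup (GammaL F n)} (hSL : SL F n ≤ G)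
    {α : Omega ω r n} {e₁ e₂ : Fin n → F} (he : e₂ ∉ Submodule.span F {e₁})
    (hα : α.1 = ray ω r e₁) {B : Set (Omega ω r n)} (hB : IsBlock (stabilizer G α) B)
    (he₂ : e₂ ∈ vectors B) :
    (∀ v ∈ vectors B, v ∈ Submodule.span F {e₁, e₂}) ∨
      ∀ v, v ∉ Submodule.span F {e₁} → v ∈ vectors B := by
  by_contra! ⟨⟨v, hv, hv'⟩, u, hu, hu'⟩
  refine hu' (mem_of_transvection_block (fun φ w h1 h2 h3 x hx => ?_) he₂ hv he hv' hu)
  obtain ⟨y, hy, hy'⟩ := h3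
  obtain ⟨g, hg, hgx⟩ := exists_SL_transvection h2
  rw [← hgx] at hy' ⊢
  exact IsBlock.map_mem_vectors hα hB (hSL hg) (by simp [hgx, h1]) hy hy' hx

omit [Finite F] in
theorem ncard_units_image (C : Subgroup Fˣ) :
    {y : F | ∃ c ∈ C, y = (c : F)}.ncard = Nat.card C := by
  have h : {y : F | ∃ c ∈ C, y = (c : F)} = Units.val '' (C : Set Fˣ) := by
    ext y
    simp [eq_comm]
  rw [h, Set.ncard_image_of_injective _ Units.val_injective, ← Nat.card_coe_set_eq]
  rfl

omit [Finite F] in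
theorem ncard_ne_zero : {y : F | y ≠ 0}.ncard = Nat.card F - 1 := by
  rw [← Nat.card_coe_set_eq, ← Nat.card_units]
  exact Nat.card_congr unitsEquivNeZero.symm

omit [Finite F] in
theorem ncard_graph (f : F → F) : {p : F × F | p.2 ≠ 0 ∧ p.1 = f p.2}.ncard = Nat.card F - 1 := by
  have h : {p : F × F | p.2 ≠ 0 ∧ p.1 = f p.2} = (fun y => (f y, y)) '' {y | y ≠ 0} := by
    ext ⟨x, y⟩
    constructor
    · rintro ⟨h, h'⟩
      exact ⟨y, h, Prod.ext h'.symm rfl⟩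
    · rintro ⟨z, hz, h⟩
      obtain ⟨rfl, rfl⟩ := Prod.mk.inj h
      exact ⟨hz, rfl⟩
  rw [h, Set.ncard_image_of_injective _ fun y z h => (Prod.mk.inj h).2, ncard_ne_zero]

end Plane

end RankThree

/-! ### From subgroups back to blocks -/

open RankThree in
theorem theorem4p8 {F : Type*} [Field F] [Finite F] (n r : ℕ) (hn : 3 ≤ n)
    (ω : Fˣ) (hω : ∀ x : Fˣ, x ∈ Subgroup.zpowers ω)
    (hr : 1 < r) (hrq : r ∣ Nat.card F - 1)
    (e : Module.Basis (Fin n) F (Fin n → F))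
    (e₁ e₂ : Fin n → F) (he₁ : e₁ = e ⟨0, by omega⟩) (he₂ : e₂ = e ⟨1, by omega⟩)
    (α β : Omega ω r n) (hα : α.1 = ray ω r e₁) (hβ : β.1 = ray ω r e₂)
    (G : Subgroup (GammaL F n)) (hG : Y ω r n ⊔ SL F n ≤ G)
    (hrank : HasRankThree G (Omega ω r n))
    (B : Set (Omega ω r n)) (hβB : β ∈ B)
    (hB : IsNontrivialBlockOn (MulAction.stabilizer G α) (sigma ω r e₁)ᶜ B) :
    (B = points ω r {v | ∃ i < r, v = ((ω ^ i : Fˣ) : F) • e₂} ∧ B.ncard = r) ∨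
    (B = points ω r {v | ∃ l : F, v = l • e₁ + e₂} ∧ B.ncard = Nat.card F) ∨
    (B = points ω r {v | ∃ l₁ l₂ : F, l₂ ≠ 0 ∧ v = l₁ • e₁ + l₂ • e₂} ∧
      B.ncard = Nat.card F * r) ∨
    (Nat.card F = 3 ∧ r = 2 ∧ B.ncard = 2 ∧
      (B = points ω r {e₂, (2 : F) • e₁ + (2 : F) • e₂} ∨
        B = points ω r {e₂, e₁ + (2 : F) • e₂})) ∨
    (Nat.card F = 4 ∧ r = 3 ∧
      ((B = points ω r {e₂, e₁ + e₂} ∧ B.ncard = 2) ∨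
        (B = points ω r {v | ∃ l : F, l ≠ 0 ∧ v = (1 + l) • e₁ + l • e₂} ∧ B.ncard = 3))) ∨
    (Nat.card F = 2 ^ 4 ∧ r = 5 ∧ B.ncard = 4 ∧
      ∃ K : Subfield F, Nat.card K = 4 ∧ B = points ω r {v | ∃ l ∈ K, v = l • e₁ + e₂}) := by
  obtain ⟨hBσ, hblock, hnt, hne⟩ := hB
  have he10 : e₁ ≠ 0 := he₁ ▸ e.ne_zero _
  have he12 : e₂ ∉ Submodule.span F {e₁} := by
    have := e.linearIndependent.notMem_span_image (s := {⟨0, by omega⟩}) (x := ⟨1, by omega⟩)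
      (by simp [Fin.ext_iff])
    rwa [Set.image_singleton, ← he₁, ← he₂] at this
  have hYG : Y ω r n ≤ G := le_sup_left.trans hG
  have hSL : SL F n ≤ G := le_sup_right.trans hG
  have he₂B : e₂ ∈ vectors B := (mem_vectors_iff hβ).2 hβB
  have hBe : ∀ v ∈ vectors B, v ∉ Submodule.span F {e₁} := by
    rintro v ⟨x, hx, hxv⟩ hv
    exact hBσ hx ((mem_sigma_iff hω hr hxv).2 hv)
  have hspan : ∀ v ∈ vectors B, v ∈ Submodule.span F {e₁, e₂} := by
    refine (IsBlock.vectors_subset_span_or hSL he12 hα hblock he₂B).resolve_right fun h => ?_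
    refine hne (hBσ.antisymm fun x hx => ?_)
    obtain ⟨u, -, hxu⟩ := x.2
    exact (mem_vectors_iff hxu).1 (h u fun hu => hx ((mem_sigma_iff hω hr hxu).2 hu))
  have hQ := isAffineSubgroup_vectors hn hSL he12 hα hblock hBe he₂B
  have hΔ := HasRankThree.transitiveOnCosets hYG hrank he10 he12
  have hclass := hQ.classification hω hr hrq hΔ
  have hcardC := card_zpowers_pow hω hr hrq
  have hcount := ncard_mul_card B
  have hrep : ∀ u ∈ vectors B, ∃ x y : F, x • e₁ + y • e₂ ∈ vectors B ∧ u = x • e₁ + y • e₂ := by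
    intro u hu
    obtain ⟨x, y, rfl⟩ := Submodule.mem_span_pair.1 (hspan u hu)
    exact ⟨x, y, hu, rfl⟩
  have hvec : (vectors B).ncard = {p : F × F | p.1 • e₁ + p.2 • e₂ ∈ vectors B}.ncard := by
    rw [← Set.ncard_image_of_injective _ (add_smul_injective he10 he12)]
    congr 1
    ext u
    constructor
    · intro hu
      obtain ⟨x, y, h, rfl⟩ := hrep u hu
      exact ⟨(x, y), h, rfl⟩
    · rintro ⟨p, hp, rfl⟩
      exact hp
  rw [hvec] at hcount
  have hC0 : 0 < Nat.card (Subgroup.zpowers (ω ^ r)) := Nat.card_pos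
  have hunit (T : Set (Fin n → F)) (hT : T ⊆ vectors B)
      (h : ∀ x y : F, x • e₁ + y • e₂ ∈ vectors B → x • e₁ + y • e₂ ∈ T) : B = points ω r T := by
    refine eq_points hT fun u hu => ?_
    obtain ⟨x, y, hxy, rfl⟩ := hrep u hu
    exact ⟨1, one_mem _, _, h x y hxy, by simp⟩
  rcases hclass with h | h | h | h | ⟨hq, hr2, a, ha0, h⟩ | ⟨hq, hr3, h⟩ | ⟨K, hqK, hrK, hK, h⟩
  -- Q = 0 ⋊ C means B = {β}, against nontriviality.
  · exfalso
    obtain ⟨x, hx, hxβ⟩ := hnt.exists_ne β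
    obtain ⟨u, -, hxu⟩ := x.2
    obtain ⟨s, y, hsy, rfl⟩ := hrep u ((mem_vectors_iff hxu).2 hx)
    obtain ⟨rfl, c, hc, rfl⟩ := (h s y).1 hsy
    refine hxβ (Subtype.ext ?_)
    rw [hxu, hβ, zero_smul, zero_add, ray_smul hc]
  · left
    have hset : {p : F × F | p.1 • e₁ + p.2 • e₂ ∈ vectors B} = {0} ×ˢ {y | y ≠ 0} := by
      ext p
      exact h p.1 p.2
    rw [hset, Set.ncard_prod, Set.ncard_singleton, one_mul, ncard_ne_zero, ← hcardC,
      mul_comm] at hcount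
    refine ⟨?_, Nat.eq_of_mul_eq_mul_left hC0 hcount⟩
    change B = sigma ω r e₂
    ext x
    obtain ⟨u, -, hxu⟩ := x.2
    rw [mem_sigma_iff hω hr hxu, ← mem_vectors_iff hxu, Submodule.mem_span_singleton]
    constructor
    · intro hu
      obtain ⟨s, y, hsy, rfl⟩ := hrep u hu
      exact ⟨y, by rw [((h s y).1 hsy).1, zero_smul, zero_add]⟩
    · rintro ⟨y, rfl⟩
      have := (h 0 y).2 ⟨rfl, fun hy => ne_zero_of_val_eq_ray hxu (by rw [hy, zero_smul])⟩
      rwa [zero_smul, zero_add] at this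
  · right; left
    have hset : {p : F × F | p.1 • e₁ + p.2 • e₂ ∈ vectors B} =
        Set.univ ×ˢ {y | ∃ c ∈ Subgroup.zpowers (ω ^ r), y = (c : F)} := by
      ext p
      exact (h p.1 p.2).trans (by simp)
    rw [hset, Set.ncard_prod, Set.ncard_univ, ncard_units_image] at hcount
    refine ⟨eq_points ?_ fun u hu => ?_, Nat.eq_of_mul_eq_mul_right hC0 hcount⟩
    · rintro _ ⟨l, rfl⟩
      have := (h l 1).2 ⟨1, one_mem _, rfl⟩
      rwa [one_smul] at this
    · obtain ⟨x, y, hxy, rfl⟩ := hrep u hu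
      obtain ⟨c, hc, rfl⟩ := (h x y).1 hxy
      exact ⟨c, hc, _, ⟨x * (c : F)⁻¹, rfl⟩, by
        rw [smul_add, smul_smul, mul_left_comm, mul_inv_cancel₀ c.ne_zero, mul_one]⟩
  · right; right; left
    have hset : {p : F × F | p.1 • e₁ + p.2 • e₂ ∈ vectors B} = Set.univ ×ˢ {y | y ≠ 0} := by
      ext p
      exact (h p.1 p.2).trans (by simp)
    rw [hset, Set.ncard_prod, Set.ncard_univ, ncard_ne_zero, ← hcardC, mul_comm,
      mul_left_comm] at hcount
    refine ⟨hunit _ ?_ fun x y hxy => ⟨x, y, (h x y).1 hxy, rfl⟩,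
      Nat.eq_of_mul_eq_mul_left hC0 hcount⟩
    rintro _ ⟨x, y, hy, rfl⟩
    exact (h x y).2 hy
  · right; right; right; left
    -- Here r = q - 1, so C is trivial and points are single vectors.
    have hC1 : Nat.card (Subgroup.zpowers (ω ^ r)) = 1 := by
      rw [hq, hr2] at hcardC
      rw [hr2]
      omega
    have hset : {p : F × F | p.1 • e₁ + p.2 • e₂ ∈ vectors B} =
        {p : F × F | p.2 ≠ 0 ∧ p.1 = a * (1 - p.2)} := by
      ext p
      exact h p.1 p.2
    rw [hset, ncard_graph fun y => a * (1 - y), hq, hC1, mul_one] at hcount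
    have h3 : (3 : F) = 0 := by
      have := Fintype.ofFinite F
      have := FiniteField.cast_card_eq_zero F
      rw [← Nat.card_eq_fintype_card, hq] at this
      exact_mod_cast this
    have h12 : ∀ y : F, y ≠ 0 → y = 1 ∨ y = 2 := by
      intro y hy
      have := Fintype.ofFinite F
      have h4 := FiniteField.pow_card_sub_one_eq_one y hy
      rw [← Nat.card_eq_fintype_card, hq] at h4
      rcases sq_eq_sq_iff_eq_or_eq_neg.1 (h4.trans (one_pow 2).symm) with h | h
      · exact Or.inl h
      · right; rw [h]; linear_combination -h3
    have h20 : (2 : F) ≠ 0 := by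
      intro h2
      exact one_ne_zero (α := F) (by linear_combination h3 - h2)
    -- The two values of a give the two exceptional blocks; the second vector has y = 2 and x = a(1
    -- - 2) = -a.
    refine ⟨hq, hr2, hcount, (h12 a ha0).imp (fun h1 => ?_) fun h2 => ?_⟩
    · refine hunit _ ?_ fun x y hxy => ?_
      · rintro _ (rfl | rfl)
        · exact he₂B
        · exact (h 2 2).2 ⟨h20, by rw [h1]; linear_combination h3⟩
      · obtain ⟨hy, rfl⟩ := (h x y).1 hxy
        rcases h12 y hy with rfl | rfl
        · left; simp
        · right
          rw [h1, show (1 : F) * (1 - 2) = 2 by linear_combination -h3]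
          rfl
    · refine hunit _ ?_ fun x y hxy => ?_
      · rintro _ (rfl | rfl)
        · exact he₂B
        · have := (h 1 2).2 ⟨h20, by rw [h2]; linear_combination h3⟩
          rwa [one_smul] at this
      · obtain ⟨hy, rfl⟩ := (h x y).1 hxy
        rcases h12 y hy with rfl | rfl
        · left; simp
        · right
          rw [h2, show (2 : F) * (1 - 2) = 1 by linear_combination -h3, one_smul]
          rfl
  · right; right; right; right; left
    have hC1 : Nat.card (Subgroup.zpowers (ω ^ r)) = 1 := by
      rw [hq, hr3] at hcardC
      rw [hr3]
      omega
    have hset : {p : F × F | p.1 • e₁ + p.2 • e₂ ∈ vectors B} =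
        {p : F × F | p.2 ≠ 0 ∧ p.1 = 1 - p.2} := by
      ext p
      exact h p.1 p.2
    rw [hset, ncard_graph fun y => 1 - y, hq, hC1, mul_one] at hcount
    have h2 : (2 : F) = 0 := by
      have := Fintype.ofFinite F
      have := FiniteField.cast_card_eq_zero F
      rw [← Nat.card_eq_fintype_card, hq] at this
      have h4 : (2 : F) ^ 2 = 0 := by norm_num; exact_mod_cast this
      exact pow_eq_zero_iff two_ne_zero |>.1 h4
    refine ⟨hq, hr3, .inr ⟨hunit _ ?_ fun x y hxy => ?_, hcount⟩⟩
    · rintro _ ⟨l, hl, rfl⟩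
      exact (h _ _).2 ⟨hl, by linear_combination l * h2⟩
    · obtain ⟨hy, rfl⟩ := (h x y).1 hxy
      exact ⟨y, hy, by rw [show 1 - y = 1 + y by linear_combination -y * h2]⟩
  · have hset : {p : F × F | p.1 • e₁ + p.2 • e₂ ∈ vectors B} =
        (K : Set F) ×ˢ {y | ∃ c ∈ Subgroup.zpowers (ω ^ r), y = (c : F)} := by
      ext p
      exact h p.1 p.2
    have hKn : (K : Set F).ncard = Nat.card K := (Nat.card_coe_set_eq _).symm
    rw [hset, Set.ncard_prod, ncard_units_image, hKn] at hcount
    have hBK := Nat.eq_of_mul_eq_mul_right hC0 hcount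
    have hK1 {l : F} (hl : l ∈ K) : l • e₁ + e₂ ∈ vectors B := by
      have := (h l 1).2 ⟨hl, 1, one_mem _, rfl⟩
      rwa [one_smul] at this
    have hBp : B = points ω r {v | ∃ l ∈ K, v = l • e₁ + e₂} := by
      refine eq_points ?_ fun u hu => ?_
      · rintro _ ⟨l, hl, rfl⟩
        exact hK1 hl
      · obtain ⟨x, y, hxy, rfl⟩ := hrep u hu
        obtain ⟨-, c, hc, rfl⟩ := (h x y).1 hxy
        have h1 := ((h _ _).1 (hQ.mul_unit_mem hxy (inv_mem hc))).1
        rw [Units.val_inv_eq_inv_val] at h1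
        -- Scaling by c⁻¹ ∈ C normalises the coefficient of e₂ to 1.
        exact ⟨c, hc, _, ⟨x * (c : F)⁻¹, h1, rfl⟩, by
          rw [smul_add, smul_smul, mul_left_comm, mul_inv_cancel₀ c.ne_zero, mul_one]⟩
    rcases hK with hK | hK
    · right; right; right; right; left
      refine ⟨by rw [hqK, hK]; norm_num, by rw [hrK, hK], .inl ⟨?_, by rw [hBK, hK]⟩⟩
      have hK01 : {0, 1} = (K : Set F) := by
        refine Set.eq_of_subset_of_ncard_le ?_ ?_
        · rintro _ (rfl | rfl)
          · exact zero_mem K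
          · exact one_mem K
        · rw [hKn, hK, Set.ncard_pair zero_ne_one]
      rw [hBp]
      congr 1
      ext v
      constructor
      · rintro ⟨l, hl, rfl⟩
        rw [← SetLike.mem_coe, ← hK01] at hl
        rcases hl with rfl | rfl
        · left; simp
        · right; simp
      · rintro (rfl | rfl)
        · exact ⟨0, zero_mem K, by simp⟩
        · exact ⟨1, one_mem K, by simp⟩
    · right; right; right; right; right
      exact ⟨by rw [hqK, hK]; norm_num, by rw [hrK, hK], by rw [hBK, hK], K, hK, hBp⟩
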